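/- Let $X$ be a Tychonoff (completely regular Hausdorff) space that is pseudocompact (every continuous function $X\to\mathbb{R}$ is bounded) and first countable. Let $C_p(X)$ be the space of all continuous functions $X\to\mathbb{R}$ and let $B_1(X)$ be the space of all Baire-one functions $X\to\mathbb{R}$ (pointwise limits of sequences of continuous functions $X\to\mathbb{R}$), both with the topology of pointwise convergence. Then the following conditions are equivalent: 1. $B_1(X)$ is a Baire space (the intersection of any sequence of dense open subsets is dense). 2. $C_p(X)$ does not have the Banakh property, i.e. there is no countable family $\{A_n : n\in\mathbb{N}\}$ of closed nowhere dense subsets of $C_p(X)$ such that every compact subset $K$ of $C_p(X)$ is contained in some $A_n$. 3. $X$ is scattered (every non-empty subspace of $X$ has an isolated point). -/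

import Mathlib

/-- A topological space is pseudocompact if every continuous real-valued function on it is bounded. -/
def IsPseudocompact (X : Type*) [TopologicalSpace X] : Prop :=
  ∀ f : X → ℝ, Continuous f → ∃ M : ℝ, ∀ x, |f x| ≤ M

/-- A topological space is scattered if every non-empty subspace has an isolated point. -/
def IsScatteredSpace (X : Type*) [TopologicalSpace X] : Prop :=
  ∀ S : Set X, S.Nonempty → ∃ x ∈ S, ∃ U : Set X, IsOpen U ∧ U ∩ S = {x}

/-- A Baire-one function: a pointwise limit of a sequence of continuous real-valued functions. -/
def IsBaireOne {X : Type*} [TopologicalSpace X] (f : X → ℝ) : Prop :=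
  ∃ g : ℕ → X → ℝ, (∀ n, Continuous (g n)) ∧
    ∀ x, Filter.Tendsto (fun n => g n x) Filter.atTop (nhds (f x))

/-- The space of continuous real-valued functions with the topology of pointwise convergence,
as a subspace of the product `X → ℝ`. -/
abbrev CpSpace (X : Type*) [TopologicalSpace X] : Type _ :=
  {f : X → ℝ // Continuous f}

/-- The space of Baire-one real-valued functions with the topology of pointwise convergence,
as a subspace of the product `X → ℝ`. -/
abbrev BaireOneSpace (X : Type*) [TopologicalSpace X] : Type _ :=
  {f : X → ℝ // IsBaireOne f}

/-- The Banakh property: there is a countable family of closed nowhere dense sets such that every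
compact set is contained in one of them. -/
def HasBanakhProperty (Y : Type*) [TopologicalSpace Y] : Prop :=
  ∃ A : ℕ → Set Y, (∀ n, IsClosed (A n) ∧ IsNowhereDense (A n)) ∧
    ∀ K : Set Y, IsCompact K → ∃ n, K ⊆ A n

open Filter Topology Set

/-! ### Basic open and closed sets for pointwise convergence -/

section PointwiseTopology

variable {X : Type*} {p : (X → ℝ) → Prop}

/-! If `X` is not scattered, it carries pairwise disjoint finite sets `Δ n ⊆ Q` such that every open
set meeting `Q` meets all but finitely many of them. The sets `{f | ∀ n ≥ m, ∃ x ∈ Δ n, f x ≤ n}`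
are closed and nowhere dense. By pseudocompactness, a pointwise bounded family of continuous
functions lies in a single one. Compact subsets of `C_p(X)` are such families, which gives the
Banakh property; so is a sequence converging to a Baire-one function, which makes `B_1(X)` meager in
itself.

If `X` is scattered, its countable subsets are Gδ (`IsScatteredSpace.isGδ_of_countable`), so
arbitrary values on a countable set extend by zero to a Baire-one function. Hence the limit of a
nested sequence of boxes is realized in `B_1(X)`. The same shrinking neighbourhoods of a countable
set yield, for any closed nowhere dense `A n`, functions `h n ∉ A n` tending pointwise to 0; they
form with 0 a compact set contained in no `A n`. -/

theorem exists_finset_forall_abs_sub_lt_mem {U : Set (Subtype p)} (hU : IsOpen U)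
    {f : Subtype p} (hf : f ∈ U) :
    ∃ F : Finset X, ∃ ε > 0, ∀ g : Subtype p, (∀ x ∈ F, |g.1 x - f.1 x| < ε) → g ∈ U := by
  obtain ⟨V, hV, rfl⟩ := isOpen_induced_iff.1 hU
  obtain ⟨I, u, hu, hIV⟩ := isOpen_pi_iff.1 hV f.1 hf
  have h : ∀ᶠ ε : ℝ in 𝓝[>] 0, ∀ a ∈ I, Metric.ball (f.1 a) ε ⊆ u a := by
    rw [Filter.eventually_all_finset]
    intro a ha
    obtain ⟨δ, hδ, hb⟩ := Metric.isOpen_iff.1 (hu a ha).1 _ (hu a ha).2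
    filter_upwards [Ioo_mem_nhdsGT hδ] with ε hε
    exact (Metric.ball_subset_ball hε.2.le).trans hb
  obtain ⟨ε, hε, hpos⟩ := (h.and self_mem_nhdsWithin).exists
  refine ⟨I, ε, hpos, fun g hg => hIV fun a ha => hε a ha ?_⟩
  rw [Metric.mem_ball, Real.dist_eq]
  exact hg a ha

theorem isOpen_setOf_forall_abs_sub_lt (F : Finset X) (v : X → ℝ) (ε : ℝ) :
    IsOpen {g : Subtype p | ∀ x ∈ F, |g.1 x - v x| < ε} := by
  simp only [ofPred_forall]
  refine isOpen_biInter_finset fun x _ => isOpen_lt ?_ continuous_const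
  exact (((continuous_apply x).comp continuous_subtype_val).sub continuous_const).abs

theorem isClosed_setOf_forall_exists_mem_le (Δ : ℕ → Finset X) (m : ℕ) :
    IsClosed {f : Subtype p | ∀ n ≥ m, ∃ x ∈ Δ n, f.1 x ≤ n} := by
  simp only [ofPred_forall]
  refine isClosed_iInter fun n => isClosed_iInter fun _ => ?_
  have : {f : Subtype p | ∃ x ∈ Δ n, f.1 x ≤ n} = ⋃ x ∈ Δ n, {f : Subtype p | f.1 x ≤ n} := by
    ext f
    simp
  rw [this]
  exact isClosed_biUnion_finset fun x _ =>
    isClosed_le ((continuous_apply x).comp continuous_subtype_val) continuous_const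

end PointwiseTopology

/-! ### Continuous interpolation on finite sets -/

section Interpolation

variable {X : Type*} [TopologicalSpace X]

theorem exists_continuous_eq_one_eqOn_zero [CompletelyRegularSpace X] {x : X} {U : Set X}
    (hU : IsOpen U) (hx : x ∈ U) :
    ∃ h : X → ℝ, Continuous h ∧ h x = 1 ∧ (∀ y, 0 ≤ h y) ∧ ∀ y ∉ U, h y = 0 := by
  obtain ⟨f, hf, hfx, hfU⟩ :=
    CompletelyRegularSpace.completely_regular x Uᶜ hU.isClosed_compl (by simpa using hx)
  refine ⟨fun y => 1 - (f y : ℝ), by fun_prop, by simp [hfx], fun y => ?_, fun y hy => ?_⟩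
  · have := (f y).2.2
    linarith
  · have : f y = 1 := hfU hy
    simp [this]

theorem exists_continuous_eqOn_finset_of_subset [T35Space X] (F : Finset X) (v : X → ℝ)
    {U : Set X} (hU : IsOpen U) (hF : ↑F ⊆ U) :
    ∃ f : X → ℝ, Continuous f ∧ (∀ x ∈ F, f x = v x) ∧ ∀ y ∉ U, f y = 0 := by
  classical
  have h : ∀ x : X, ∃ h : X → ℝ, Continuous h ∧
      (x ∈ F → h x = 1 ∧ (∀ y ∈ F, y ≠ x → h y = 0) ∧ ∀ y ∉ U, h y = 0) := by
    intro x
    by_cases hx : x ∈ F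
    · obtain ⟨h, hc, h1, -, h0⟩ := exists_continuous_eq_one_eqOn_zero
        (hU.sdiff (F.erase x).finite_toSet.isClosed) (x := x) ⟨hF hx, by simp⟩
      refine ⟨h, hc, fun _ => ⟨h1, fun y hy hyx => h0 y ?_, fun y hy => h0 y fun h' => hy h'.1⟩⟩
      exact fun h' => h'.2 (by simp [hy, hyx])
    · exact ⟨0, continuous_const, fun h => absurd h hx⟩
  choose h hc hh using h
  refine ⟨fun y => ∑ x ∈ F, v x * h x y, by fun_prop, fun y hy => ?_, fun y hy => ?_⟩
  · simp only
    rw [Finset.sum_eq_single_of_mem y hy, (hh y hy).1, mul_one]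
    intro x hx hxy
    rw [(hh x hx).2.1 y hy hxy.symm, mul_zero]
  · refine Finset.sum_eq_zero fun x hx => ?_
    rw [(hh x hx).2.2 y hy, mul_zero]

theorem exists_continuous_eqOn_finset [T35Space X] (F : Finset X) (v : X → ℝ) :
    ∃ f : X → ℝ, Continuous f ∧ ∀ x ∈ F, f x = v x :=
  let ⟨f, hc, hf, _⟩ := exists_continuous_eqOn_finset_of_subset F v isOpen_univ (subset_univ _)
  ⟨f, hc, hf⟩

theorem exists_continuous_eqOn_finset_of_abs_le [T35Space X] (F : Finset X) (v : X → ℝ) {ε : ℝ}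
    (hε : 0 ≤ ε) (hv : ∀ x ∈ F, |v x| ≤ ε) :
    ∃ f : X → ℝ, Continuous f ∧ (∀ x ∈ F, f x = v x) ∧ ∀ x, |f x| ≤ ε := by
  obtain ⟨f, hc, hf⟩ := exists_continuous_eqOn_finset F v
  refine ⟨fun x => max (-ε) (min ε (f x)), by fun_prop, fun x hx => ?_, fun x => ?_⟩
  · have := abs_le.1 (hv x hx)
    simp only [hf x hx]
    rw [min_eq_right this.2, max_eq_right this.1]
  · exact abs_le.2 ⟨le_max_left _ _, max_le (by linarith) (min_le_left _ _)⟩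

theorem IsBaireOne.of_continuous {f : X → ℝ} (hf : Continuous f) : IsBaireOne f :=
  ⟨fun _ => f, fun _ => hf, fun _ => tendsto_const_nhds⟩

end Interpolation

/-! ### Consequences of pseudocompactness -/

section Pseudocompact

variable {X : Type*} [TopologicalSpace X]

/-- Otherwise bumps of height `n` supported in `U n` form a locally finite family, whose sum is
continuous and unbounded. -/
theorem IsPseudocompact.nonempty_iInter_closure [CompletelyRegularSpace X]
    (hX : IsPseudocompact X) {U : ℕ → Set X} (hU : ∀ n, IsOpen (U n)) (hne : ∀ n, (U n).Nonempty)
    (hanti : Antitone U) : (⋂ n, closure (U n)).Nonempty := by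
  by_contra hempty
  rw [not_nonempty_iff_eq_empty] at hempty
  choose x hx using hne
  choose h hc h1 hpos h0 using fun n => exists_continuous_eq_one_eqOn_zero (hU n) (hx n)
  have hsupp : ∀ n : ℕ, Function.support (fun y => (n : ℝ) * h n y) ⊆ U n := by
    intro n y hy
    by_contra hyn
    exact hy (by simp [h0 n y hyn])
  have hlf : LocallyFinite fun n : ℕ => Function.support fun y => (n : ℝ) * h n y := by
    intro y
    have hy : y ∉ ⋂ n, closure (U n) := by simp [hempty]
    simp only [mem_iInter, not_forall] at hy
    obtain ⟨n, hn⟩ := hy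
    refine ⟨(closure (U n))ᶜ, isClosed_closure.isOpen_compl.mem_nhds hn, ?_⟩
    refine (finite_lt_nat n).subset ?_
    rintro m ⟨z, hzm, hz⟩
    by_contra hmn
    exact hz (subset_closure (hanti (not_lt.1 hmn) (hsupp m hzm)))
  obtain ⟨M, hM⟩ := hX _ (continuous_finsum (fun n => continuous_const.mul (hc n)) hlf)
  obtain ⟨n, hn⟩ := exists_nat_gt M
  have hle : (n : ℝ) * h n (x n) ≤ ∑ᶠ m : ℕ, (m : ℝ) * h m (x n) :=
    single_le_finsum n (hlf.point_finite (x n)) fun m => mul_nonneg m.cast_nonneg (hpos m _)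
  rw [h1, mul_one] at hle
  exact absurd ((le_abs_self _).trans (hM (x n))) (not_le.2 (hn.trans_le hle))

/-- A pointwise bounded family of continuous functions on a pseudocompact space cannot be large on
infinitely many members of a sequence of finite sets that eventually meets every open set that
meets `Q`. -/
theorem IsPseudocompact.exists_forall_exists_mem_le [CompletelyRegularSpace X]
    (hX : IsPseudocompact X) {Q : Set X} (hQ : Q.Nonempty) {Δ : ℕ → Finset X}
    (hΔQ : ∀ n, ↑(Δ n) ⊆ Q)
    (hΔ : ∀ U, IsOpen U → (U ∩ Q).Nonempty → ∀ᶠ n in atTop, ∃ x ∈ Δ n, x ∈ U)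
    {G : Set (X → ℝ)} (hG : ∀ g ∈ G, Continuous g) (hb : ∀ x, ∃ M, ∀ g ∈ G, g x ≤ M) :
    ∃ m, ∀ n ≥ m, ∀ g ∈ G, ∃ x ∈ Δ n, g x ≤ n := by
  by_contra! hcon
  let S := {U : Set X // IsOpen U ∧ (U ∩ Q).Nonempty}
  have step : ∀ (i : ℕ) (U : S), ∃ V : S, V.1 ⊆ U.1 ∧ ∃ g ∈ G, ∀ y ∈ V.1, (i : ℝ) ≤ g y := by
    rintro i ⟨U, hUo, hUQ⟩
    obtain ⟨m, hm⟩ := eventually_atTop.1 (hΔ U hUo hUQ)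
    obtain ⟨n, hn, g, hg, hgn⟩ := hcon (max m i)
    obtain ⟨x, hx, hxU⟩ := hm n (le_of_max_le_left hn)
    refine ⟨⟨U ∩ {y | (n : ℝ) < g y}, hUo.inter (isOpen_lt continuous_const (hG g hg)),
      x, ⟨hxU, hgn x hx⟩, hΔQ n hx⟩, inter_subset_left, g, hg, fun y hy => ?_⟩
    have h1 : (i : ℝ) ≤ n := by exact_mod_cast le_of_max_le_right hn
    exact h1.trans (le_of_lt hy.2)
  choose V hVU g hg hgV using step
  -- On `W (n + 1)`, hence on its closure, one member of `G` is at least `n`; a point in all the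
  -- closures contradicts pointwise boundedness.
  let W : ℕ → S := fun n => Nat.rec ⟨univ, isOpen_univ, by simpa using hQ⟩ V n
  have hanti : Antitone fun n => (W n).1 := antitone_nat_of_succ_le fun n => hVU n (W n)
  obtain ⟨x, hx⟩ := hX.nonempty_iInter_closure (fun n => (W n).2.1)
    (fun n => (W n).2.2.mono inter_subset_left) hanti
  obtain ⟨M, hM⟩ := hb x
  obtain ⟨n, hn⟩ := exists_nat_gt M
  have hcl : closure (W (n + 1)).1 ⊆ {y | (n : ℝ) ≤ g n (W n) y} :=
    closure_minimal (hgV n (W n)) (isClosed_le continuous_const (hG _ (hg n (W n))))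
  have := hcl (mem_iInter.1 hx (n + 1))
  exact absurd (hM _ (hg n (W n))) (not_le.2 (hn.trans_le this))

end Pseudocompact

/-! ### Finite sets witnessing non-scatteredness -/

section NotScattered

variable {X : Type*} [TopologicalSpace X]

/-- A first countable space that is not scattered contains a set `Q` and disjoint finite subsets of
`Q` such that every open set meeting `Q` meets all but finitely many of them. -/
theorem exists_finset_seq_of_not_isScatteredSpace [T1Space X] [FirstCountableTopology X]
    (h : ¬ IsScatteredSpace X) :
    ∃ (Q : Set X) (Δ : ℕ → Finset X), Q.Nonempty ∧ (∀ n, ↑(Δ n) ⊆ Q) ∧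
      (∀ U, IsOpen U → (U ∩ Q).Nonempty → ∀ᶠ n in atTop, ∃ x ∈ Δ n, x ∈ U) ∧
      ∀ x, ∀ᶠ n in atTop, x ∉ Δ n := by
  classical
  simp only [IsScatteredSpace, not_forall] at h
  obtain ⟨S, ⟨x₀, hx₀⟩, hS⟩ := h
  have hS' : ∀ x ∈ S, ∀ U, IsOpen U → x ∈ U → ∃ y ∈ S, y ∈ U ∧ y ≠ x := by
    intro x hx U hU hxU
    by_contra! hcon
    refine hS ⟨x, hx, U, hU, ?_⟩
    ext y
    simp only [mem_inter_iff, mem_singleton_iff]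
    exact ⟨fun hy => hcon y hy.2 hy.1, by rintro rfl; exact ⟨hxU, hx⟩⟩
  choose b hb using fun x : X => (nhds_basis_opens x).exists_antitone_subbasis
  have hs : ∀ (x : S) (j : ℕ), ∃ y : S, y.1 ∈ b x j ∧ y ≠ x := by
    rintro ⟨x, hx⟩ j
    obtain ⟨y, hy, hyU, hyx⟩ := hS' x hx (b x j) ((hb x).1 j).2 ((hb x).1 j).1
    exact ⟨⟨y, hy⟩, hyU, fun h => hyx (congrArg Subtype.val h)⟩
  choose s hsb hsne using hs
  -- Closing `x₀` under the maps `s · j` gives a countable set without isolated points.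
  let q : List ℕ → S := fun l => l.rec ⟨x₀, hx₀⟩ fun j _ y => s y j
  let Q : Set X := range fun l => (q l).1
  have hinf : ∀ (l : List ℕ) (j : ℕ), (b (q l).1 j ∩ Q).Infinite := by
    intro l j hfin
    have hopen : IsOpen (b (q l).1 j \ ((b (q l).1 j ∩ Q) \ {(q l).1})) :=
      ((hb _).1 j).2.sdiff (hfin.subset sdiff_subset).isClosed
    obtain ⟨k, hk⟩ := (hb (q l).1).2.mem_iff.1
      (hopen.mem_nhds ⟨((hb (q l).1).1 j).1, by simp⟩)
    have h1 := hk (hsb (q l) k)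
    have h2 : (s (q l) k).1 ∈ Q := ⟨k :: l, rfl⟩
    exact h1.2 ⟨⟨h1.1, h2⟩, fun h => hsne (q l) k (Subtype.ext h)⟩
  obtain ⟨e, he⟩ := exists_surjective_nat (List ℕ × ℕ)
  let B : ℕ → Set X := fun i => b (q (e i).1).1 (e i).2
  -- The first component is a strictly increasing counter, so the `n`-th finite set meets `B i` for
  -- all `i ≤ n`.
  obtain ⟨f, hfP, hfr⟩ := exists_seq_of_forall_finset_exists
    (fun c : ℕ × Finset X => ↑c.2 ⊆ Q ∧ ∀ i ≤ c.1, ∃ x ∈ c.2, x ∈ B i)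
    (fun c d => c.1 < d.1 ∧ Disjoint c.2 d.2) (by
      intro T _
      choose y hy hyT using fun i =>
        (hinf (e i).1 (e i).2).exists_notMem_finset (T.biUnion fun c => c.2)
      refine ⟨(T.sup (fun c => c.1) + 1,
        (Finset.range (T.sup (fun c => c.1) + 2)).image y), ⟨?_, ?_⟩, ?_⟩
      · intro x hx
        simp only [Finset.coe_image, mem_image] at hx
        obtain ⟨i, -, rfl⟩ := hx
        exact (hy i).2
      · intro i hi
        exact ⟨y i, Finset.mem_image_of_mem _ (Finset.mem_range.2 (Nat.lt_succ_of_le hi)),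
          (hy i).1⟩
      · intro c hc
        refine ⟨Nat.lt_succ_of_le (Finset.le_sup (f := fun c : ℕ × Finset X => c.1) hc), ?_⟩
        rw [Finset.disjoint_left]
        intro x hxc hx
        obtain ⟨i, -, rfl⟩ := Finset.mem_image.1 hx
        exact hyT i (Finset.mem_biUnion.2 ⟨c, hc, hxc⟩))
  have hmono : StrictMono fun n => (f n).1 := fun m n hmn => (hfr m n hmn).1
  refine ⟨Q, fun n => (f n).2, ⟨x₀, [], rfl⟩, fun n => (hfP n).1, ?_, fun x => ?_⟩
  · rintro U hU ⟨_, hlU, l, rfl⟩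
    obtain ⟨k, hk⟩ := (hb (q l).1).2.mem_iff.1 (hU.mem_nhds hlU)
    obtain ⟨i, hi⟩ := he (l, k)
    filter_upwards [eventually_ge_atTop i] with n hn
    obtain ⟨x, hx, hxB⟩ := (hfP n).2 i (hn.trans hmono.le_apply)
    refine ⟨x, hx, hk ?_⟩
    simpa only [B, hi] using hxB
  · by_cases hx : ∃ m, x ∈ (f m).2
    · obtain ⟨m, hm⟩ := hx
      filter_upwards [eventually_gt_atTop m] with n hn
      exact Finset.disjoint_left.1 (hfr m n hn).2 hm
    · exact Eventually.of_forall fun n hn => hx ⟨n, hn⟩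

/-- A basic neighbourhood constrains only a finite set `F`; some `Δ n` with `n ≥ m` misses `F`,
leaving the value `n + 1` free to be prescribed there. -/
theorem interior_setOf_forall_exists_mem_le [T35Space X] {p : (X → ℝ) → Prop}
    {Δ : ℕ → Finset X} (hp : ∀ f, Continuous f → p f) (hΔ : ∀ x, ∀ᶠ n in atTop, x ∉ Δ n) (m : ℕ) :
    interior {f : Subtype p | ∀ n ≥ m, ∃ x ∈ Δ n, f.1 x ≤ n} = ∅ := by
  classical
  rw [eq_empty_iff_forall_notMem]
  intro f hf
  obtain ⟨F, ε, hε, hF⟩ := exists_finset_forall_abs_sub_lt_mem isOpen_interior hf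
  obtain ⟨n, hn, hmn⟩ := (((Filter.eventually_all_finset F).2 fun x _ => hΔ x).and
    (eventually_ge_atTop m)).exists
  obtain ⟨g, hc, hg⟩ := exists_continuous_eqOn_finset (F ∪ Δ n)
    fun x => if x ∈ F then f.1 x else n + 1
  have hgm := interior_subset (hF ⟨g, hp g hc⟩ fun x hx => by simp [hg, hx, hε])
  obtain ⟨x, hx, hgx⟩ := hgm n hmn
  have hxF : x ∉ F := fun h => hn x h hx
  simp only [hg x (Finset.mem_union_right _ hx), hxF, if_false] at hgx
  linarith

end NotScattered

/-! ### Scattered spaces: countable sets are Gδ, and its consequences -/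

section Scattered

variable {X : Type*} [TopologicalSpace X]

theorem exists_isOpen_isGδ_compl_subset [CompletelyRegularSpace X] {x : X} {U : Set X}
    (hU : IsOpen U) (hx : x ∈ U) : ∃ V ⊆ U, x ∈ V ∧ IsOpen V ∧ IsGδ Vᶜ := by
  obtain ⟨h, hc, h1, -, h0⟩ := exists_continuous_eq_one_eqOn_zero hU hx
  refine ⟨h ⁻¹' {0}ᶜ, fun y hy => ?_, by simp [h1], isOpen_compl_singleton.preimage hc, ?_⟩
  · by_contra hyU
    exact hy (h0 y hyU)
  · rw [preimage_compl, compl_compl]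
    exact (IsGδ.singleton 0).preimage hc

theorem IsScatteredSpace.isGδ_of_countable [T35Space X] [FirstCountableTopology X]
    (hX : IsScatteredSpace X) {D : Set X} (hD : D.Countable) : IsGδ D := by
  -- `T` collects the points where `D` is locally Gδ. These pieces glue because `T` is countable and
  -- each `U d` is an Fσ; an isolated point of the remainder `D \ V` would itself lie in `T`.
  let T : Set X := {d ∈ D | ∃ U, d ∈ U ∧ IsOpen U ∧ IsGδ Uᶜ ∧ IsGδ (U ∩ D)}
  have hT : T.Countable := hD.mono (sep_subset _ _)
  choose! U hdU hUo hUc hUD using fun d (hd : d ∈ T) => hd.2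
  let V : Set X := ⋃ d ∈ T, U d
  have hVo : IsOpen V := isOpen_biUnion hUo
  have hV : V ∩ D = V ∩ ⋂ d ∈ T, ((U d)ᶜ ∪ U d ∩ D) := by
    ext x
    simp only [V, mem_inter_iff, mem_iUnion, mem_iInter, mem_union, mem_compl_iff]
    constructor
    · rintro ⟨h1, h2⟩
      exact ⟨h1, fun d _ => by tauto⟩
    · rintro ⟨⟨d, hd, hx⟩, h2⟩
      refine ⟨⟨d, hd, hx⟩, ?_⟩
      have := h2 d hd
      tauto
  have hVD : IsGδ (V ∩ D) := by
    rw [hV]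
    exact hVo.isGδ.inter (.biInter hT fun d hd => (hUc d hd).union (hUD d hd))
  by_cases hS : (D \ V).Nonempty
  · obtain ⟨d, hd, W, hW, hWd⟩ := hX _ hS
    obtain ⟨W', hW', hdW', hWo, hWc⟩ :=
      exists_isOpen_isGδ_compl_subset hW (hWd.symm.subset rfl).1
    have : W' ∩ D = (W' ∩ (V ∩ D)) ∪ {d} := by
      ext x
      simp only [mem_inter_iff, mem_union, mem_singleton_iff]
      constructor
      · rintro ⟨h1, h2⟩
        by_cases hxV : x ∈ V
        · exact .inl ⟨h1, hxV, h2⟩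
        · exact .inr (hWd.subset ⟨hW' h1, h2, hxV⟩)
      · rintro (h | rfl)
        · exact ⟨h.1, h.2.2⟩
        · exact ⟨hdW', hd.1⟩
    have hdT : d ∈ T := by
      refine ⟨hd.1, W', hdW', hWo, hWc, ?_⟩
      rw [this]
      exact (hWo.isGδ.inter hVD).union (.singleton d)
    exact absurd (mem_biUnion hdT (hdU d hdT)) hd.2
  · rw [not_nonempty_iff_eq_empty, sdiff_eq_empty] at hS
    rwa [inter_eq_right.2 hS] at hVD

theorem IsGδ.exists_antitone_isOpen {D : Set X} (hD : IsGδ D) :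
    ∃ O : ℕ → Set X, (∀ n, IsOpen (O n)) ∧ (∀ n, D ⊆ O n) ∧ ∀ x ∉ D, ∀ᶠ n in atTop, x ∉ O n := by
  obtain ⟨f, hf, rfl⟩ := hD.eq_iInter_nat
  refine ⟨fun n => ⋂ i ≤ n, f i, fun n => (finite_le_nat n).isOpen_biInter fun i _ => hf i,
    fun n x hx => mem_iInter₂.2 fun i _ => mem_iInter.1 hx i, fun x hx => ?_⟩
  simp only [mem_iInter, not_forall] at hx
  obtain ⟨i, hi⟩ := hx
  filter_upwards [eventually_ge_atTop i] with n hn h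
  exact hi (mem_iInter₂.1 h i hn)

theorem IsGδ.isBaireOne_indicator_iUnion [T35Space X] {F : ℕ → Finset X} (hF : Monotone F)
    (hD : IsGδ (⋃ n, (F n : Set X))) (v : X → ℝ) :
    IsBaireOne ((⋃ n, (F n : Set X)).indicator v) := by
  obtain ⟨O, hO, hDO, hO'⟩ := hD.exists_antitone_isOpen
  choose f hc hf hf0 using fun n => exists_continuous_eqOn_finset_of_subset (F n) v (hO n)
    ((subset_iUnion (fun n => (F n : Set X)) n).trans (hDO n))
  refine ⟨f, hc, fun x => tendsto_nhds_of_eventually_eq ?_⟩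
  by_cases hx : x ∈ ⋃ n, (F n : Set X)
  · rw [indicator_of_mem hx]
    obtain ⟨m, hm⟩ := mem_iUnion.1 hx
    filter_upwards [eventually_ge_atTop m] with n hn
    exact hf n x (hF hn hm)
  · rw [indicator_of_notMem hx]
    filter_upwards [hO' x hx] with n hn
    exact hf0 n x hn

theorem IsScatteredSpace.baireSpace_baireOneSpace [T35Space X] [FirstCountableTopology X]
    (hX : IsScatteredSpace X) : BaireSpace (BaireOneSpace X) := by
  classical
  refine ⟨fun G hGo hGd => dense_iff_inter_open.2 ?_⟩
  rintro U hU ⟨f₀, hf₀⟩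
  -- A box: finite support, centre and positive radius. The centre need not be Baire-one.
  let S := {c : Finset X × (X → ℝ) × ℝ // 0 < c.2.2}
  have step : ∀ (n : ℕ) (c : S), ∃ d : S, c.1.1 ⊆ d.1.1 ∧
      (∀ y : X → ℝ, (∀ x ∈ d.1.1, |y x - d.1.2.1 x| ≤ d.1.2.2) →
        ∀ x ∈ c.1.1, |y x - c.1.2.1 x| ≤ c.1.2.2) ∧
      ∀ y : BaireOneSpace X, (∀ x ∈ d.1.1, |y.1 x - d.1.2.1 x| ≤ d.1.2.2) → y ∈ G n := by
    rintro n ⟨⟨F, v, ε⟩, hε⟩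
    simp only at hε
    obtain ⟨h, hhc, hh⟩ := exists_continuous_eqOn_finset F v
    obtain ⟨g, hgv, hgG⟩ := (hGd n).inter_open_nonempty _
      (isOpen_setOf_forall_abs_sub_lt F v (ε / 2))
      ⟨⟨h, .of_continuous hhc⟩, fun x hx => by simp [hh x hx, hε]⟩
    obtain ⟨F', δ, hδ, hF'⟩ := exists_finset_forall_abs_sub_lt_mem (hGo n) hgG
    refine ⟨⟨⟨F ∪ F', g.1, min (ε / 2) (δ / 2)⟩, by simp only; positivity⟩,
      Finset.subset_union_left, fun y hy x hx => ?_, fun y hy => hF' y fun x hx => ?_⟩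
    · have h1 := (hy x (Finset.mem_union_left _ hx)).trans (min_le_left _ _)
      have h2 : |g.1 x - v x| < ε / 2 := hgv x hx
      have h3 := abs_sub_le (y x) (g.1 x) (v x)
      simp only at h1 ⊢
      linarith
    · have h1 := (hy x (Finset.mem_union_right _ hx)).trans (min_le_right _ _)
      simp only at h1
      linarith
  choose nxt hsub hbox hG using step
  obtain ⟨F₀, ε₀, hε₀, hF₀⟩ := exists_finset_forall_abs_sub_lt_mem hU hf₀
  let c : ℕ → S := fun n => Nat.rec ⟨⟨F₀, f₀.1, ε₀ / 2⟩, half_pos hε₀⟩ nxt n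
  have hFmono : Monotone fun n => (c n).1.1 := monotone_nat_of_le_succ fun n => hsub n (c n)
  let C : ℕ → Set (X → ℝ) := fun n => {y | ∀ x ∈ (c n).1.1, |y x - (c n).1.2.1 x| ≤ (c n).1.2.2}
  have hC : Antitone C := antitone_nat_of_succ_le fun n y hy => hbox n (c n) y hy
  have hv : ∀ n, (c n).1.2.1 ∈ C n := fun n x _ => by simp [(c n).2.le]
  -- At each coordinate the boxes eventually project to nested compact intervals, or never constrain
  -- it.
  have hL : ∀ x, ∃ L : ℝ, ∀ n, x ∈ (c n).1.1 → |L - (c n).1.2.1 x| ≤ (c n).1.2.2 := by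
    intro x
    by_cases hx : ∃ m, x ∈ (c m).1.1
    · obtain ⟨m, hm⟩ := hx
      by_contra! hcon
      choose k hk hkL using hcon
      obtain ⟨L, hL⟩ : (⋂ n, (fun y : X → ℝ => y x) '' C (m + n)).Nonempty := by
        have himg : ∀ n, (fun y : X → ℝ => y x) '' C (m + n) =
            Metric.closedBall ((c (m + n)).1.2.1 x) (c (m + n)).1.2.2 := by
          intro n
          ext t
          rw [Metric.mem_closedBall, Real.dist_eq]
          constructor
          · rintro ⟨y, hy, rfl⟩
            exact hy x (hFmono (Nat.le_add_right m n) hm)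
          · intro ht
            refine ⟨Function.update (c (m + n)).1.2.1 x t, fun z hz => ?_, by simp⟩
            rcases eq_or_ne z x with rfl | hzx
            · simpa using ht
            · simpa [hzx] using (c (m + n)).2.le
        refine IsCompact.nonempty_iInter_of_sequence_nonempty_isCompact_isClosed _
          (fun n => image_mono (hC (Nat.add_le_add_left (Nat.le_succ n) m)))
          (fun n => ⟨_, _, hv _, rfl⟩) ?_ fun n => ?_
        · rw [himg]
          exact isCompact_closedBall _ _
        · rw [himg]
          exact Metric.isClosed_closedBall
      obtain ⟨y, hy, hyL⟩ := mem_iInter.1 hL (k L)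
      have := hC (Nat.le_add_left (k L) m) hy x (hk L)
      simp only at hyL
      rw [hyL] at this
      exact absurd this (not_le.2 (hkL L))
    · exact ⟨0, fun n hn => absurd ⟨n, hn⟩ hx⟩
  choose L hL using hL
  let D : Set X := ⋃ n, ((c n).1.1 : Set X)
  have hD : IsGδ D := hX.isGδ_of_countable (countable_iUnion fun n => (c n).1.1.countable_toSet)
  let y : BaireOneSpace X := ⟨D.indicator L, hD.isBaireOne_indicator_iUnion hFmono L⟩
  have hy : ∀ n, ∀ x ∈ (c n).1.1, |y.1 x - (c n).1.2.1 x| ≤ (c n).1.2.2 := by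
    intro n x hx
    have hxD : x ∈ D := mem_iUnion.2 ⟨n, hx⟩
    simpa only [y, indicator_of_mem hxD] using hL x n hx
  refine ⟨y, hF₀ y fun x hx => ?_, mem_iInter.2 fun n => hG n (c n) y (hy (n + 1))⟩
  exact (hy 0 x hx).trans_lt (half_lt_self hε₀)

theorem IsScatteredSpace.not_hasBanakhProperty [T35Space X] [FirstCountableTopology X]
    (hX : IsScatteredSpace X) : ¬ HasBanakhProperty (CpSpace X) := by
  classical
  rintro ⟨A, hA, hK⟩
  have step : ∀ (n : ℕ) (F : Finset X), ∃ (F' : Finset X) (g : X → ℝ), F ⊆ F' ∧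
      (∀ x ∈ F, |g x| ≤ 1 / ((n : ℝ) + 1)) ∧
      ∀ h : CpSpace X, (∀ x ∈ F', h.1 x = g x) → h ∉ A n := by
    intro n F
    have hd : Dense (A n)ᶜ := by
      have := (hA n).2
      rw [IsNowhereDense, (hA n).1.closure_eq] at this
      exact interior_eq_empty_iff_dense_compl.1 this
    obtain ⟨g, hg, hgA⟩ := hd.inter_open_nonempty _
      (isOpen_setOf_forall_abs_sub_lt F (fun _ => 0) (1 / ((n : ℝ) + 1)))
      ⟨⟨fun _ => 0, continuous_const⟩, fun x _ => by simp; positivity⟩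
    obtain ⟨F', ε, hε, hF'⟩ := exists_finset_forall_abs_sub_lt_mem (hA n).1.isOpen_compl hgA
    refine ⟨F ∪ F', g.1, Finset.subset_union_left, fun x hx => ?_, fun h hh => hF' h fun x hx => ?_⟩
    · simpa using (hg x hx).le
    · simp [hh x (Finset.mem_union_right _ hx), hε]
  choose nxt g hsub hg hgA using step
  obtain ⟨F, hF⟩ : ∃ F : ℕ → Finset X, ∀ n, F (n + 1) = nxt n (F n) :=
    ⟨fun n => Nat.rec ∅ nxt n, fun _ => rfl⟩
  have hFmono : Monotone F := monotone_nat_of_le_succ fun n => hF n ▸ hsub n (F n)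
  let D : Set X := ⋃ n, (F n : Set X)
  have hFD : ∀ n, (F n : Set X) ⊆ D := fun n _ hx => mem_iUnion.2 ⟨n, hx⟩
  obtain ⟨O, hO, hDO, hO'⟩ :=
    (hX.isGδ_of_countable (countable_iUnion fun n => (F n).countable_toSet) :
      IsGδ D).exists_antitone_isOpen
  -- `a n` is uniformly small and matches the target on `F n`; `b n` corrects it on `F (n + 1) \ F
  -- n` and vanishes off `O n \ F n`, so at each point `b n` is eventually 0.
  choose a hac hag ha using fun n =>
    exists_continuous_eqOn_finset_of_abs_le (F n) (g n (F n)) (by positivity) (hg n (F n))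
  choose b hbc hbg hb using fun n : ℕ =>
    exists_continuous_eqOn_finset_of_subset (F (n + 1) \ F n) (fun x => g n (F n) x - a n x)
      ((hO n).sdiff (F n).finite_toSet.isClosed) (fun x hx => by
        rw [Finset.coe_sdiff] at hx
        exact ⟨hDO n (hFD (n + 1) hx.1), hx.2⟩)
  let h : ℕ → CpSpace X := fun n => ⟨fun x => a n x + b n x, (hac n).add (hbc n)⟩
  have hhA : ∀ n, h n ∉ A n := by
    refine fun n => hgA n (F n) (h n) fun x hx => ?_
    rw [← hF] at hx
    change a n x + b n x = _
    by_cases hxF : x ∈ F n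
    · rw [hb n x fun h => h.2 hxF, hag n x hxF, add_zero]
    · rw [hbg n x (Finset.mem_sdiff.2 ⟨hx, hxF⟩)]
      ring
  have hlim : Tendsto h atTop (𝓝 ⟨fun _ => 0, continuous_const⟩) := by
    rw [tendsto_subtype_rng, tendsto_pi_nhds]
    intro x
    have ha0 : Tendsto (fun n => a n x) atTop (𝓝 0) :=
      squeeze_zero_norm (fun n => ha n x) tendsto_one_div_add_atTop_nhds_zero_nat
    have hb0 : Tendsto (fun n => b n x) atTop (𝓝 0) := by
      refine tendsto_nhds_of_eventually_eq ?_
      by_cases hx : x ∈ D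
      · obtain ⟨m, hm⟩ := mem_iUnion.1 hx
        filter_upwards [eventually_ge_atTop m] with n hn
        exact hb n x fun h => h.2 (hFmono hn hm)
      · filter_upwards [hO' x hx] with n hn
        exact hb n x fun h => hn h.1
    simpa using ha0.add hb0
  obtain ⟨n, hn⟩ := hK _ hlim.isCompact_insert_range
  exact hhA n (hn (.inr (mem_range_self n)))

end Scattered

/-! ### Either condition forces scatteredness -/

section Converse

variable {X : Type*} [TopologicalSpace X] [T35Space X] [FirstCountableTopology X]

theorem IsPseudocompact.isScatteredSpace_of_baireSpace (hX : IsPseudocompact X)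
    (hB : BaireSpace (BaireOneSpace X)) : IsScatteredSpace X := by
  by_contra hns
  obtain ⟨Q, Δ, hQ, hΔQ, hΔU, hΔ⟩ := exists_finset_seq_of_not_isScatteredSpace hns
  have : Nonempty (BaireOneSpace X) := ⟨⟨fun _ => 0, .of_continuous continuous_const⟩⟩
  obtain ⟨m, f, hf⟩ := nonempty_interior_of_iUnion_of_closed
    (isClosed_setOf_forall_exists_mem_le (p := IsBaireOne) Δ) (by
      rw [eq_univ_iff_forall]
      rintro ⟨f, g, hgc, hgf⟩
      obtain ⟨m, hm⟩ := hX.exists_forall_exists_mem_le hQ hΔQ hΔU (G := range g)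
        (forall_mem_range.2 hgc) fun x => by
          obtain ⟨M, hM⟩ := (hgf x).bddAbove_range
          exact ⟨M, forall_mem_range.2 fun n => hM (mem_range_self n)⟩
      refine mem_iUnion.2 ⟨m, fun n hn => ?_⟩
      -- A limit exceeding `n` on the finite set `Δ n` forces some `g k` to exceed `n` there too.
      by_contra! hcon
      obtain ⟨k, hk⟩ := ((Filter.eventually_all_finset (Δ n)).2 fun x hx =>
        (hgf x).eventually_const_lt (hcon x hx)).exists
      obtain ⟨x, hx, hgx⟩ := hm n hn (g k) (mem_range_self k)
      exact absurd (hk x hx) (not_lt.2 hgx))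
  rw [interior_setOf_forall_exists_mem_le (fun _ => .of_continuous) hΔ] at hf
  exact hf

theorem IsPseudocompact.isScatteredSpace_of_not_hasBanakhProperty (hX : IsPseudocompact X)
    (hB : ¬ HasBanakhProperty (CpSpace X)) : IsScatteredSpace X := by
  by_contra hns
  obtain ⟨Q, Δ, hQ, hΔQ, hΔU, hΔ⟩ := exists_finset_seq_of_not_isScatteredSpace hns
  refine hB ⟨_, fun m => ⟨isClosed_setOf_forall_exists_mem_le Δ m, ?_⟩, fun K hK => ?_⟩
  · rw [IsNowhereDense, (isClosed_setOf_forall_exists_mem_le Δ m).closure_eq,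
      interior_setOf_forall_exists_mem_le (fun _ => id) hΔ]
  · obtain ⟨m, hm⟩ := hX.exists_forall_exists_mem_le hQ hΔQ hΔU (G := Subtype.val '' K)
      (by rintro _ ⟨f, -, rfl⟩; exact f.2) fun x => by
        obtain ⟨M, hM⟩ := hK.bddAbove_image
          ((continuous_apply x).comp continuous_subtype_val).continuousOn
        refine ⟨M, ?_⟩
        rintro _ ⟨f, hf, rfl⟩
        exact hM ⟨f, hf, rfl⟩
    exact ⟨m, fun f hf n hn => hm n hn f.1 ⟨f, hf, rfl⟩⟩

end Converse

theorem mainTheorem3 (X : Type*) [TopologicalSpace X] [T35Space X] [FirstCountableTopology X]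
    (hX : IsPseudocompact X) :
    [BaireSpace (BaireOneSpace X),
      ¬ HasBanakhProperty (CpSpace X),
      IsScatteredSpace X].TFAE := by
  tfae_have 1 → 3 := hX.isScatteredSpace_of_baireSpace
  tfae_have 2 → 3 := hX.isScatteredSpace_of_not_hasBanakhProperty
  tfae_have 3 → 1 := fun h => h.baireSpace_baireOneSpace
  tfae_have 3 → 2 := fun h => h.not_hasBanakhProperty
  tfae_finish
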